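/- Let $k\in\mathbb N$ and let $\lambda_1,\dots,\lambda_k,\gamma_1,\dots,\gamma_k:[0,\infty)\to[0,\infty)$ be deterministic intensity functions with finite integrals on bounded intervals. For $0\le s\le t$ write $$\Lambda_j(s,t)=\int_s^t\lambda_j(u)\,du,\qquad T_j(s,t)=\int_s^t\gamma_j(u)\,du,\qquad \Lambda_j(t)=\Lambda_j(0,t),\qquad T_j(t)=T_j(0,t).$$ A non-homogeneous generalized counting process (NGCP) with intensities $\lambda_1,\dots,\lambda_k$ is a process $\{M(t)\}_{t\ge0}$ with values in $\{0,1,2,\dots\}$ such that $M(0)=0$, $M$ has independent increments, and for all $0\le s\le t$ and all integers $n\ge0$ $$P\{M(t)-M(s)=n\}=\sum_{\substack{x_1,\dots,x_k\ge 0\\ x_1+2x_2+\cdots+kx_k=n}}\ \prod_{j=1}^{k}\frac{\Lambda_j(s,t)^{x_j}}{x_j!}\;e^{-\sum_{j=1}^k\Lambda_j(s,t)}.$$ Let $\{M_1(t)\}_{t\ge0}$ and $\{M_2(t)\}_{t\ge0}$ be two independent NGCPs on a probability space, with intensities $\lambda_1,\dots,\lambda_k$ and $\gamma_1,\dots,\gamma_k$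 respectively, and let $S(t)=M_1(t)-M_2(t)$ be the corresponding non-homogeneous generalized Skellam process (NGSP). Then the process $$\Big\{S(t)-\sum_{j=1}^{k}j\,\big(\Lambda_j(t)-T_j(t)\big)\Big\}_{t\ge0}$$ is a martingale with respect to the natural filtration $\mathcal F_t=\sigma\big(S(s),\,0<s\le t\big)$, $t\ge0$. -/

import Mathlib

open MeasureTheory ProbabilityTheory
open scoped NNReal

noncomputable section

namespace Skellam

/-- A family of deterministic intensity functions `λ₁, …, λₖ : [0, ∞) → [0, ∞)` with finite
cumulative rates `∫₀ᵗ λⱼ(u) du < ∞` for every `t ≥ 0`. The intensity `λⱼ` of jumps of size `j` is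
stored at the index `j - 1 : Fin k`; only the values on `[0, ∞)` matter. -/
structure IsIntensity {k : ℕ} (lam : Fin k → ℝ → ℝ) : Prop where
  nonneg : ∀ j, ∀ u, 0 ≤ u → 0 ≤ lam j u
  integrable : ∀ j, ∀ t : ℝ≥0, IntervalIntegrable (lam j) volume 0 t

/-- The cumulative rate `∫ₛᵗ f(u) du`. -/
def cumRate (f : ℝ → ℝ) (s t : ℝ≥0) : ℝ := ∫ u in (s : ℝ)..(t : ℝ), f u

/-- The set of all `(x₁, …, xₖ)` of natural numbers with `∑ⱼ j xⱼ = n` (the bound `xⱼ ≤ n`, which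
makes this visibly a finite set, follows from the equation). -/
def jumpCounts (k n : ℕ) : Finset (Fin k → ℕ) :=
  (Fintype.piFinset fun _ : Fin k => Finset.range (n + 1)).filter
    fun x => ∑ j : Fin k, ((j : ℕ) + 1) * x j = n

/-- The probability that a non-homogeneous generalized counting process with intensities
`λ₁, …, λₖ` increases by `n` between the times `s ≤ t`:
`∑_{x₁ + 2 x₂ + ⋯ + k xₖ = n} ∏ⱼ Λⱼ(s,t)^{xⱼ} / xⱼ! · exp (-∑ⱼ Λⱼ(s,t))`. -/
def incrementProb {k : ℕ} (lam : Fin k → ℝ → ℝ) (s t : ℝ≥0) (n : ℕ) : ℝ :=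
  ∑ x ∈ jumpCounts k n,
    (∏ j, cumRate (lam j) s t ^ x j / (Nat.factorial (x j) : ℝ)) *
      Real.exp (-∑ j, cumRate (lam j) s t)

/-- `M` is a non-homogeneous generalized counting process (NGCP) with intensities `λ₁, …, λₖ`:
it starts at `0`, has independent increments, and its increments have the distribution
`incrementProb`. Regularity of the paths is not required. -/
structure IsNGCP {Ω : Type*} [MeasurableSpace Ω] (P : Measure Ω) {k : ℕ}
    (lam : Fin k → ℝ → ℝ) (M : ℝ≥0 → Ω → ℕ) : Prop where
  measurable : ∀ t, Measurable (M t)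
  zero : ∀ ω, M 0 ω = 0
  indepIncrements : HasIndepIncrements (fun t ω => (M t ω : ℤ)) P
  increment_law : ∀ s t : ℝ≥0, s ≤ t → ∀ n : ℕ,
    P.real {ω | (M t ω : ℤ) - (M s ω : ℤ) = (n : ℤ)} = incrementProb lam s t n

/-- `S` is a non-homogeneous generalized Skellam process (NGSP) with intensities `λⱼ`, `γⱼ`: the
difference of two independent NGCPs with intensities `λⱼ` and `γⱼ` respectively. -/
def IsNGSP {Ω : Type*} [MeasurableSpace Ω] (P : Measure Ω) {k : ℕ}
    (lam gam : Fin k → ℝ → ℝ) (S : ℝ≥0 → Ω → ℤ) : Prop :=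
  ∃ M₁ M₂ : ℝ≥0 → Ω → ℕ, IsNGCP P lam M₁ ∧ IsNGCP P gam M₂ ∧
    IndepFun (fun ω t => M₁ t ω) (fun ω t => M₂ t ω) P ∧
    ∀ t ω, S t ω = (M₁ t ω : ℤ) - (M₂ t ω : ℤ)

theorem IsNGSP.measurable {Ω : Type*} [MeasurableSpace Ω] {P : Measure Ω} {k : ℕ}
    {lam gam : Fin k → ℝ → ℝ} {S : ℝ≥0 → Ω → ℤ} (h : IsNGSP P lam gam S) (t : ℝ≥0) :
    Measurable (S t) := by
  obtain ⟨M₁, M₂, h₁, h₂, -, hS⟩ := h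
  have e : S t = fun ω => (M₁ t ω : ℤ) - (M₂ t ω : ℤ) := funext (hS t)
  rw [e]
  exact (measurable_from_top.comp (h₁.measurable t)).sub
    (measurable_from_top.comp (h₂.measurable t))

/-- The filtration `ℱₜ = σ(S(s), 0 < s ≤ t)` generated by the process `S`. -/
def naturalFiltration {Ω : Type*} [m : MeasurableSpace Ω] (S : ℝ≥0 → Ω → ℤ)
    (hS : ∀ t, Measurable (S t)) : Filtration ℝ≥0 m where
  seq t := ⨆ s ∈ Set.Ioc 0 t, MeasurableSpace.comap (S s) inferInstance
  mono' _ _ h := biSup_mono fun _ hs => ⟨hs.1, hs.2.trans h⟩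
  le' _ := iSup₂_le fun s _ => (hS s).comap_le

end Skellam

end

/-!
If an integrable adapted process has increments independent of the past, then
`E[X t | ℱ s] = X s + E[X t - X s]`, so the process becomes a martingale once its mean is
subtracted. The Skellam process has such increments: the difference of two independent processes
with independent increments has independent increments, and the past up to time `s` is determined by
finite families of times, for which it is a function of finitely many increments before `s`.
For the mean, the law of `M t` is that of `∑ⱼ j Nⱼ` for independent Poisson variables `Nⱼ` of
parameters `Λⱼ(t)`, so `E[M t] = ∑ⱼ j Λⱼ(t)`.
-/

namespace Skellam

section Independence

variable {Ω ι : Type*} {mΩ : MeasurableSpace Ω} {P : Measure Ω}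

theorem iIndepFun_prodMk {α β : ι → Type*} [∀ i, MeasurableSpace (α i)]
    [∀ i, MeasurableSpace (β i)] {X : ∀ i, Ω → α i} {Y : ∀ i, Ω → β i}
    (hXm : ∀ i, Measurable (X i)) (hYm : ∀ i, Measurable (Y i))
    (hX : iIndepFun X P) (hY : iIndepFun Y P)
    (hXY : IndepFun (fun ω i => X i ω) (fun ω i => Y i ω) P) :
    iIndepFun (fun i ω => (X i ω, Y i ω)) P := by
  refine iIndepSets.iIndep (fun i => ((hXm i).prodMk (hYm i)).comap_le) _
    (fun i => isPiSystem_prod.comap fun ω => (X i ω, Y i ω))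
    (fun i => (congrArg (MeasurableSpace.comap fun ω => (X i ω, Y i ω))
      generateFrom_prod.symm).trans MeasurableSpace.comap_generateFrom)
    ((iIndepSets_iff _ _).2 fun I f hf => ?_)
  choose! D hD hDf using hf
  choose! A hA B hB hAB using hD
  have hf_eq : ∀ i ∈ I, f i = X i ⁻¹' A i ∩ Y i ⁻¹' B i := fun i hi => by
    rw [← hDf i hi, ← hAB i hi]
    rfl
  have hI : ⋂ i ∈ I, f i =
      (fun ω i => X i ω) ⁻¹' (I : Set ι).pi A ∩ (fun ω i => Y i ω) ⁻¹' (I : Set ι).pi B := by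
    ext ω
    simp +contextual only [hf_eq, Set.mem_iInter, Set.mem_inter_iff, Set.mem_preimage, Set.mem_pi,
      SetLike.mem_coe, forall_and]
  have hXA : (fun ω i => X i ω) ⁻¹' (I : Set ι).pi A = ⋂ i ∈ I, X i ⁻¹' A i := by
    ext ω
    simp
  have hYB : (fun ω i => Y i ω) ⁻¹' (I : Set ι).pi B = ⋂ i ∈ I, Y i ⁻¹' B i := by
    ext ω
    simp
  have hXYi : ∀ i, IndepFun (X i) (Y i) P := fun i =>
    hXY.comp (measurable_pi_apply i) (measurable_pi_apply i)
  calc P (⋂ i ∈ I, f i)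
    _ = P (⋂ i ∈ I, X i ⁻¹' A i) * P (⋂ i ∈ I, Y i ⁻¹' B i) := by
      rw [hI, hXY.measure_inter_preimage_eq_mul _ _ (.pi I.countable_toSet hA)
        (.pi I.countable_toSet hB), hXA, hYB]
    _ = ∏ i ∈ I, P (X i ⁻¹' A i) * P (Y i ⁻¹' B i) := by
      rw [hX.measure_inter_preimage_eq_mul I hA, hY.measure_inter_preimage_eq_mul I hB,
        Finset.prod_mul_distrib]
    _ = ∏ i ∈ I, P (f i) := Finset.prod_congr rfl fun i hi => by
      rw [hf_eq i hi, (hXYi i).measure_inter_preimage_eq_mul _ _ (hA i hi) (hB i hi)]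

variable {T E : Type*} [MeasurableSpace E] [AddCommGroup E] [MeasurableSub₂ E]

theorem hasIndepIncrements_sub [Preorder T] {X Y : T → Ω → E} (hXm : ∀ t, Measurable (X t))
    (hYm : ∀ t, Measurable (Y t)) (hX : HasIndepIncrements X P) (hY : HasIndepIncrements Y P)
    (hXY : IndepFun (fun ω t => X t ω) (fun ω t => Y t ω) P) :
    HasIndepIncrements (fun t ω => X t ω - Y t ω) P := by
  intro n t ht
  have hincr : Measurable fun (x : T → E) (i : Fin n) => x (t i.succ) - x (t i.castSucc) := by
    fun_prop
  have hpair := iIndepFun_prodMk (fun i : Fin n => (hXm (t i.succ)).sub (hXm (t i.castSucc)))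
    (fun i : Fin n => (hYm (t i.succ)).sub (hYm (t i.castSucc))) (hX n t ht) (hY n t ht)
    (hXY.comp hincr hincr)
  refine (hpair.comp (fun _ z => z.1 - z.2) fun _ => measurable_fst.sub measurable_snd).congr
    fun i => .of_forall fun ω => ?_
  exact sub_sub_sub_comm _ _ _ _

theorem exists_monotone_range_eq [LinearOrder T] {J : Finset T} (hJ : J.Nonempty) :
    ∃ τ : ℕ → T, Monotone τ ∧ Set.range τ = J := by
  obtain ⟨n, hn⟩ : ∃ n, J.card = n + 1 := Nat.exists_eq_succ_of_ne_zero hJ.card_pos.ne'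
  refine ⟨fun i => J.orderEmbOfFin hn (Fin.clamp i n), fun i j hij => ?_, ?_⟩
  · exact (J.orderEmbOfFin hn).monotone (min_le_min_right n hij)
  · have hclamp : Function.Surjective fun i => Fin.clamp i n :=
      fun i => ⟨i, Fin.ext (min_eq_left (Nat.lt_succ_iff.1 i.is_lt))⟩
    rw [← J.range_orderEmbOfFin hn]
    exact hclamp.range_comp (J.orderEmbOfFin hn)

variable [MeasurableAdd₂ E] {X : T → Ω → E}

theorem indepFun_increment_monotone_seq [Preorder T] (hX : HasIndepIncrements X P)
    (hXm : ∀ t, Measurable (X t)) {τ : ℕ → T} (hτ : Monotone τ) (h0 : ∀ ω, X (τ 0) ω = 0)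
    {a b : ℕ} (hab : a ≤ b) :
    IndepFun (fun ω => X (τ b) ω - X (τ a) ω) (fun ω (i : Set.Iic a) => X (τ i) ω) P := by
  have hblocks := (hX.nat hτ).indepFun_finset (Finset.Ico a b) (Finset.range a)
    (Finset.disjoint_left.2 fun i hi hi' =>
      (Finset.mem_range.1 hi').not_ge (Finset.mem_Ico.1 hi).1)
    fun i => (hXm _).sub (hXm _)
  have hnext : Measurable fun y : Finset.Ico a b → E => ∑ l, y l := by fun_prop
  have hpast : Measurable fun (y : Finset.range a → E) (i : Set.Iic a) =>
      ∑ l : Finset.range i, y ⟨l, Finset.range_mono i.2 l.2⟩ := by fun_prop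
  refine (hblocks.comp hnext hpast).congr (.of_forall fun ω => ?_)
    (.of_forall fun ω => funext fun i => ?_)
  · simp only [Function.comp_apply]
    rw [Finset.sum_coe_sort _ fun l => X (τ (l + 1)) ω - X (τ l) ω,
      Finset.sum_Ico_sub (fun l => X (τ l) ω) hab]
  · simp only [Function.comp_apply]
    rw [Finset.sum_coe_sort _ fun l => X (τ (l + 1)) ω - X (τ l) ω,
      Finset.sum_range_sub fun l => X (τ l) ω, h0, sub_zero]

theorem indepFun_increment_past [LinearOrder T] [OrderBot T] [IsProbabilityMeasure P]
    (hX : HasIndepIncrements X P) (hXm : ∀ t, Measurable (X t)) (h0 : ∀ ω, X ⊥ ω = 0) {s t : T}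
    (hst : s ≤ t) :
    IndepFun (fun ω => X t ω - X s ω) (fun ω (u : Set.Iic s) => X u ω) P := by
  refine IndepFun.indepFun_process ((hXm t).sub (hXm s)) (fun u => hXm u) fun I => ?_
  obtain ⟨τ, hτ, hrange⟩ :=
    exists_monotone_range_eq (J := {⊥, s, t} ∪ I.image Subtype.val) ⟨⊥, by simp⟩
  have hmem : ∀ u, u = ⊥ ∨ u = s ∨ u = t ∨ (∃ v ∈ I, v = u) → ∃ i, τ i = u := fun u hu => by
    rw [← Set.mem_range, hrange]
    simpa [or_assoc] using hu
  obtain ⟨a, rfl⟩ := hmem s (by simp)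
  obtain ⟨b, rfl⟩ := hmem t (by simp)
  have hτ0 : τ 0 = ⊥ := by
    obtain ⟨i, hi⟩ := hmem ⊥ (by simp)
    exact le_bot_iff.1 (hi ▸ hτ i.zero_le)
  -- An increasing map commutes with `max` and `min`, so the indices of `s ≤ t` and of the times
  -- `u ≤ s` may be replaced by correctly ordered ones, even where `τ` is not injective.
  have hτb : τ (max a b) = τ b := by rw [hτ.map_max, max_eq_right hst]
  choose i hi using fun u : I => hmem u.1 (.inr (.inr (.inr ⟨u.1, u.2, rfl⟩)))
  have hτi : ∀ u : I, τ (min (i u) a) = u := fun u => by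
    rw [hτ.map_min, hi, min_eq_left u.1.2]
  have hseq := indepFun_increment_monotone_seq hX hXm hτ (by rwa [hτ0]) (le_max_left a b)
  have heval : Measurable fun (y : Set.Iic a → E) (u : I) =>
      y ⟨min (i u) a, Set.mem_Iic.2 (min_le_right _ _)⟩ := by fun_prop
  refine (hseq.comp measurable_id heval).congr (.of_forall fun ω => ?_)
    (.of_forall fun ω => funext fun u => ?_)
  · simp only [Function.comp_apply, id, hτb]
  · simp only [Function.comp_apply, hτi]

end Independence

theorem martingale_sub_integral_of_indep_increment {Ω T E : Type*} [Preorder T]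
    {mΩ : MeasurableSpace Ω} {P : Measure Ω} [IsFiniteMeasure P] [NormedAddCommGroup E]
    [NormedSpace ℝ E] [CompleteSpace E] [MeasurableSpace E] [BorelSpace E]
    [SecondCountableTopology E] {ℱ : Filtration T mΩ} {X : T → Ω → E}
    (hadapted : StronglyAdapted ℱ X) (hint : ∀ t, Integrable (X t) P)
    (hindep : ∀ s t, s ≤ t →
      Indep (MeasurableSpace.comap (fun ω => X t ω - X s ω) inferInstance) (ℱ s) P) :
    Martingale (fun t ω => X t ω - ∫ ω', X t ω' ∂P) ℱ P := by
  refine ⟨fun t => (hadapted t).sub stronglyMeasurable_const, fun s t hst => ?_⟩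
  set c : E := ∫ ω, X t ω ∂P
  have hincr : Measurable fun ω => X t ω - X s ω :=
    ((hadapted t).mono (ℱ.le t)).measurable.sub ((hadapted s).mono (ℱ.le s)).measurable
  have hcond_incr : P[X t - X s | ℱ s] =ᵐ[P] fun _ => c - ∫ ω, X s ω ∂P :=
    (condExp_indep_eq hincr.comap_le (ℱ.le s) (comap_measurable _).stronglyMeasurable
      (hindep s t hst)).trans (.of_eq (funext fun _ => integral_sub (hint t) (hint s)))
  have hpast_int : Integrable (X s - fun _ => c) P := (hint s).sub (integrable_const c)
  have hcond_past : P[X s - fun _ => c | ℱ s] = X s - fun _ => c :=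
    condExp_of_stronglyMeasurable (ℱ.le s) ((hadapted s).sub stronglyMeasurable_const) hpast_int
  have hdecomp : (fun ω => X t ω - c) = (X t - X s) + (X s - fun _ => c) := by
    ext ω
    simp
  change P[fun ω => X t ω - c | ℱ s] =ᵐ[P] fun ω => X s ω - ∫ ω', X s ω' ∂P
  rw [hdecomp]
  filter_upwards [hcond_incr, condExp_add ((hint t).sub (hint s)) hpast_int (ℱ s)] with ω hω hadd
  rw [hadd, Pi.add_apply, hω, hcond_past, Pi.sub_apply]
  abel

section Poisson

theorem hasSum_poisson_mul_natCast (r : ℝ≥0) :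
    HasSum (fun n : ℕ => Real.exp (-r) * (r : ℝ) ^ n / (n.factorial : ℝ) * n) r := by
  rw [← hasSum_nat_add_iff' 1]
  have hshift := (hasSum_one_poissonMeasure r).mul_right (r : ℝ)
  simp only [Finset.range_one, Finset.sum_singleton, Nat.cast_zero, mul_zero, sub_zero]
  rw [one_mul] at hshift
  refine hshift.congr_fun fun n => ?_
  rw [Nat.factorial_succ]
  push_cast
  field_simp
  ring

theorem integrable_natCast_poissonMeasure (r : ℝ≥0) :
    Integrable (fun n : ℕ => (n : ℝ)) (poissonMeasure r) := by
  simpa [integrable_poissonMeasure_iff] using (hasSum_poisson_mul_natCast r).summable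

theorem integral_natCast_poissonMeasure (r : ℝ≥0) :
    ∫ n : ℕ, (n : ℝ) ∂(poissonMeasure r) = r := by
  simpa [integral_poissonMeasure] using (hasSum_poisson_mul_natCast r).tsum_eq

variable {ι : Type*} [Fintype ι]

theorem pi_poissonMeasure_real_singleton (r : ι → ℝ≥0) (x : ι → ℕ) :
    (Measure.pi fun i => poissonMeasure (r i)).real {x} =
      (∏ i, (r i : ℝ) ^ x i / ((x i).factorial : ℝ)) * Real.exp (-∑ i, (r i : ℝ)) := by
  rw [measureReal_def, Measure.pi_singleton, ENNReal.toReal_prod, ← Finset.sum_neg_distrib,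
    Real.exp_sum, ← Finset.prod_mul_distrib]
  refine Finset.prod_congr rfl fun i _ => ?_
  rw [← measureReal_def, poissonMeasure_real_singleton]
  ring

theorem integrable_sum_mul_pi_poissonMeasure (r : ι → ℝ≥0) (c : ι → ℝ) :
    Integrable (fun x : ι → ℕ => ∑ i, c i * x i) (Measure.pi fun i => poissonMeasure (r i)) :=
  integrable_finsetSum _ fun _ _ =>
    (integrable_comp_eval (integrable_natCast_poissonMeasure _)).const_mul _

theorem integral_sum_mul_pi_poissonMeasure (r : ι → ℝ≥0) (c : ι → ℝ) :
    ∫ x : ι → ℕ, ∑ i, c i * x i ∂(Measure.pi fun i => poissonMeasure (r i)) =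
      ∑ i, c i * r i := by
  rw [integral_finsetSum _ fun i _ =>
    (integrable_comp_eval (integrable_natCast_poissonMeasure _)).const_mul _]
  refine Finset.sum_congr rfl fun i _ => ?_
  have hmarginal := integral_comp_eval (i := i) (f := fun n : ℕ => (n : ℝ))
    (μ := fun i => poissonMeasure (r i)) .of_discrete
  rw [integral_const_mul, hmarginal, integral_natCast_poissonMeasure]

end Poisson

section CountingProcess

theorem mem_jumpCounts {k n : ℕ} {x : Fin k → ℕ} :
    x ∈ jumpCounts k n ↔ ∑ j : Fin k, ((j : ℕ) + 1) * x j = n := by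
  simp only [jumpCounts, Finset.mem_filter, Fintype.mem_piFinset, Finset.mem_range,
    Nat.lt_succ_iff, and_iff_right_iff_imp]
  rintro rfl j
  calc x j ≤ ((j : ℕ) + 1) * x j := Nat.le_mul_of_pos_left _ (Nat.succ_pos _)
    _ ≤ ∑ i : Fin k, ((i : ℕ) + 1) * x i :=
      Finset.single_le_sum (f := fun i : Fin k => ((i : ℕ) + 1) * x i)
        (fun _ _ => Nat.zero_le _) (Finset.mem_univ j)

variable {Ω : Type*} [MeasurableSpace Ω] {P : Measure Ω} {k : ℕ} {lam : Fin k → ℝ → ℝ}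

theorem IsIntensity.cumRate_nonneg (h : IsIntensity lam) (j : Fin k) {s t : ℝ≥0} (hst : s ≤ t) :
    0 ≤ cumRate (lam j) s t :=
  intervalIntegral.integral_nonneg hst fun u hu => h.nonneg j u (s.2.trans hu.1)

/-- The joint law of the numbers of jumps of sizes `1, …, k` up to time `t` of a non-homogeneous
generalized counting process: independent Poisson variables of parameters `Λⱼ(t)`. The truncation
`Real.toNNReal` is harmless, as `Λⱼ(t)` is nonnegative for an intensity. -/
noncomputable def jumpLaw (lam : Fin k → ℝ → ℝ) (t : ℝ≥0) : Measure (Fin k → ℕ) :=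
  Measure.pi fun j => poissonMeasure (cumRate (lam j) 0 t).toNNReal

instance (t : ℝ≥0) : IsProbabilityMeasure (jumpLaw lam t) := by
  unfold jumpLaw
  infer_instance

theorem IsIntensity.jumpLaw_real_jumpCounts (h : IsIntensity lam) (t : ℝ≥0) (n : ℕ) :
    (jumpLaw lam t).real (jumpCounts k n) = incrementProb lam 0 t n := by
  simp only [← sum_measureReal_singleton, jumpLaw, pi_poissonMeasure_real_singleton,
    Real.coe_toNNReal _ (h.cumRate_nonneg _ (zero_le : 0 ≤ t)), incrementProb]

theorem IsIntensity.integral_jumpLaw (h : IsIntensity lam) (t : ℝ≥0) (c : Fin k → ℝ) :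
    ∫ x : Fin k → ℕ, ∑ j, c j * x j ∂(jumpLaw lam t) = ∑ j, c j * cumRate (lam j) 0 t := by
  simp only [jumpLaw, integral_sum_mul_pi_poissonMeasure,
    Real.coe_toNNReal _ (h.cumRate_nonneg _ (zero_le : 0 ≤ t))]

variable [IsProbabilityMeasure P] {M : ℝ≥0 → Ω → ℕ}

theorem IsNGCP.identDistrib (hM : IsNGCP P lam M) (h : IsIntensity lam) (t : ℝ≥0) :
    IdentDistrib (M t) (fun x : Fin k → ℕ => ∑ j : Fin k, ((j : ℕ) + 1) * x j) P
      (jumpLaw lam t) where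
  aemeasurable_fst := (hM.measurable t).aemeasurable
  aemeasurable_snd := .of_discrete
  map_eq := by
    refine ext_iff_measureReal_singleton.2 fun n => ?_
    have hpre : (fun x : Fin k → ℕ => ∑ j : Fin k, ((j : ℕ) + 1) * x j) ⁻¹' {n} =
        jumpCounts k n := by
      ext x
      simp [mem_jumpCounts]
    rw [map_measureReal_apply (hM.measurable t) (measurableSet_singleton n),
      map_measureReal_apply .of_discrete (measurableSet_singleton n), hpre,
      h.jumpLaw_real_jumpCounts, ← hM.increment_law 0 t zero_le n]
    congr 1
    ext ω
    simp [hM.zero]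

theorem IsNGCP.identDistrib_real (hM : IsNGCP P lam M) (h : IsIntensity lam) (t : ℝ≥0) :
    IdentDistrib (fun ω => (M t ω : ℝ))
      (fun x : Fin k → ℕ => ∑ j : Fin k, ((j : ℕ) + 1 : ℝ) * x j) P (jumpLaw lam t) := by
  simpa [Function.comp_def] using
    (hM.identDistrib h t).comp (measurable_from_top : Measurable fun n : ℕ => (n : ℝ))

theorem IsNGCP.integrable (hM : IsNGCP P lam M) (h : IsIntensity lam) (t : ℝ≥0) :
    Integrable (fun ω => (M t ω : ℝ)) P :=
  (hM.identDistrib_real h t).integrable_iff.2 (integrable_sum_mul_pi_poissonMeasure _ _)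

theorem IsNGCP.integral_eq (hM : IsNGCP P lam M) (h : IsIntensity lam) (t : ℝ≥0) :
    ∫ ω, (M t ω : ℝ) ∂P = ∑ j : Fin k, ((j : ℕ) + 1 : ℝ) * cumRate (lam j) 0 t := by
  rw [(hM.identDistrib_real h t).integral_eq, h.integral_jumpLaw]

end CountingProcess

section SkellamProcess

variable {Ω : Type*} [MeasurableSpace Ω] {P : Measure Ω} {k : ℕ} {lam gam : Fin k → ℝ → ℝ}
  {S : ℝ≥0 → Ω → ℤ}

theorem naturalFiltration_le_comap_past (hS : ∀ t, Measurable (S t)) (s : ℝ≥0) :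
    naturalFiltration S hS s ≤
      MeasurableSpace.comap (fun ω (u : Set.Iic s) => S u ω) inferInstance :=
  iSup₂_le fun u hu => ((measurable_pi_apply (⟨u, hu.2⟩ : Set.Iic s)).comp
    (comap_measurable fun ω (u : Set.Iic s) => S u ω)).comap_le

theorem measurable_naturalFiltration (hS : ∀ t, Measurable (S t)) (h0 : ∀ ω, S 0 ω = 0)
    (t : ℝ≥0) : Measurable[naturalFiltration S hS t] (S t) := by
  obtain rfl | ht := eq_or_ne t 0
  · rw [show S 0 = fun _ => 0 from funext h0]
    exact measurable_const
  · exact (comap_measurable (S t)).mono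
      (le_iSup₂_of_le t ⟨pos_iff_ne_zero.2 ht, le_rfl⟩ le_rfl) le_rfl

theorem IsNGSP.zero (hS : IsNGSP P lam gam S) (ω : Ω) : S 0 ω = 0 := by
  obtain ⟨M₁, M₂, h₁, h₂, -, hS⟩ := hS
  simp [hS, h₁.zero, h₂.zero]

theorem IsNGSP.hasIndepIncrements (hS : IsNGSP P lam gam S) : HasIndepIncrements S P := by
  obtain ⟨M₁, M₂, h₁, h₂, hind, hS⟩ := hS
  obtain rfl : S = fun t ω => (M₁ t ω : ℤ) - M₂ t ω := funext₂ hS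
  have hcast : Measurable fun (x : ℝ≥0 → ℕ) t => (x t : ℤ) :=
    measurable_pi_lambda _ fun t => measurable_from_top.comp (measurable_pi_apply t)
  exact hasIndepIncrements_sub (fun t => measurable_from_top.comp (h₁.measurable t))
    (fun t => measurable_from_top.comp (h₂.measurable t)) h₁.indepIncrements h₂.indepIncrements
    (hind.comp hcast hcast)

theorem IsNGSP.stronglyAdapted (hS : IsNGSP P lam gam S) :
    StronglyAdapted (naturalFiltration S hS.measurable) fun t ω => (S t ω : ℝ) := fun t =>
  (measurable_from_top.comp
    (measurable_naturalFiltration hS.measurable hS.zero t)).stronglyMeasurable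

variable [IsProbabilityMeasure P]

theorem IsNGSP.indep_increment (hS : IsNGSP P lam gam S) {s t : ℝ≥0} (hst : s ≤ t) :
    Indep (MeasurableSpace.comap (fun ω => (S t ω : ℝ) - S s ω) inferInstance)
      (naturalFiltration S hS.measurable s) P := by
  have hpast := indepFun_increment_past hS.hasIndepIncrements hS.measurable hS.zero hst
  have hcast := hpast.comp (measurable_from_top : Measurable fun z : ℤ => (z : ℝ)) measurable_id
  simp only [Function.comp_def, Int.cast_sub] at hcast
  exact indep_of_indep_of_le_right ((IndepFun_iff_Indep _ _ _).1 hcast)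
    (naturalFiltration_le_comap_past hS.measurable s)

theorem IsNGSP.integrable (hS : IsNGSP P lam gam S) (hlam : IsIntensity lam)
    (hgam : IsIntensity gam) (t : ℝ≥0) : Integrable (fun ω => (S t ω : ℝ)) P := by
  obtain ⟨M₁, M₂, h₁, h₂, -, hS⟩ := hS
  simpa [hS, Pi.sub_def] using (h₁.integrable hlam t).sub (h₂.integrable hgam t)

theorem IsNGSP.integral_eq (hS : IsNGSP P lam gam S) (hlam : IsIntensity lam)
    (hgam : IsIntensity gam) (t : ℝ≥0) :
    ∫ ω, (S t ω : ℝ) ∂P =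
      ∑ j : Fin k, ((j : ℕ) + 1 : ℝ) * (cumRate (lam j) 0 t - cumRate (gam j) 0 t) := by
  obtain ⟨M₁, M₂, h₁, h₂, -, hS⟩ := hS
  simp only [hS, Int.cast_sub, Int.cast_natCast, mul_sub, Finset.sum_sub_distrib]
  rw [integral_sub (h₁.integrable hlam t) (h₂.integrable hgam t), h₁.integral_eq hlam,
    h₂.integral_eq hgam]

end SkellamProcess

end Skellam

theorem mainTheorem6 {Ω : Type*} [MeasurableSpace Ω] (P : Measure Ω) [IsProbabilityMeasure P]
    (k : ℕ) (lam gam : Fin k → ℝ → ℝ)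
    (hlam : Skellam.IsIntensity lam) (hgam : Skellam.IsIntensity gam)
    (S : ℝ≥0 → Ω → ℤ) (hS : Skellam.IsNGSP P lam gam S) :
    Martingale
      (fun (t : ℝ≥0) (ω : Ω) => (S t ω : ℝ) -
        ∑ j : Fin k, ((j : ℕ) + 1 : ℝ) *
          (Skellam.cumRate (lam j) 0 t - Skellam.cumRate (gam j) 0 t))
      (Skellam.naturalFiltration S hS.measurable) P := by
  have hmart : Martingale (fun t ω => (S t ω : ℝ) - ∫ ω', (S t ω' : ℝ) ∂P)
      (Skellam.naturalFiltration S hS.measurable) P :=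
    Skellam.martingale_sub_integral_of_indep_increment hS.stronglyAdapted
      (hS.integrable hlam hgam) fun _ _ => hS.indep_increment
  simpa only [hS.integral_eq hlam hgam] using hmart
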